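/- **Definitions.** Let $S^n$ be the conformal $n$-sphere (the unit sphere of $\mathbb R^{n+1}$), and let $\Gamma=I_1\times\dots\times I_m\subseteq\mathbb Z^m$ be a product of (finite or infinite) integer intervals, with standard direction vectors $t_1,\dots,t_m$. A map $F:\Gamma\to S^n$ is a *discrete curvature line net* if the vertices $F(t),F(t+t_i),F(t+t_i+t_j),F(t+t_j)$, $i\ne j$, of each elementary quadrilateral have real cross ratio (equivalently, are concircular). It is *nondegenerate* if each elementary quadrilateral has four distinct vertices and the eight vertices of an elementary 3-cell never all lie on one circle. The *$k$-dimensional subnet* through $o\in\Gamma$ in the directions $J\subseteq\{1,\dots,m\}$, $|J|=k$, is the restriction to $\{t\in\Gamma: t_i=o_i \text{ for } i\notin J\}$. Two corresponding $k$-dimensional subnets of discrete curvature line nets $F,\hat F$ *envelope a discrete Ribaucour $k$-sphere congruence* if the vertices of any two corresponding elementary $k$-cells lie on a common $k$-sphere. Two discrete curvature line nets with $F(t)\ne\hat F(t)$ for all $t\in\Gamma$ form a *discrete Ribaucour pair of orthogonal nets* if for all $1\le j\le m$ any two corresponding elementary $j$-cells lie on a common $j$-sphere and the endpoints of corresponding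 edges do not separate each other on the circle they lie on (either net may degenerate, e.g. be constant). **Theorem (Cauchy problem).** Let $2\le k\le m$ and $o\in\Gamma$. 1. A nondegenerate discrete curvature line net $F:\Gamma\to S^n$ is determined by its $k$-dimensional subnets through $o$ in all $\binom mk$ coordinate directions: every discrete curvature line net $G:\Gamma\to S^n$ that agrees with $F$ on them equals $F$. Moreover, each vertex of an elementary 3-cell of $F$ can be reconstructed from the other seven: if $p_1,p_2,p_3$ are the neighbours of one vertex $p_0$ of the cell, $p_{ij}$ is the fourth vertex of the quadrilateral containing $p_0,p_i,p_j$, and $p_{123}$ is the vertex opposite to $p_0$, then $p_{123}$ is the only common point of the circles through $p_1,p_{12},p_{13}$, through $p_2,p_{12},p_{23}$, and through $p_3,p_{13},p_{23}$. 2. Let $F,\hat F:\Gamma\to S^n$ be nondegenerate discrete curvature line nets whose $k$-dimensional subnets through $o$ pairwise envelope discrete Ribaucour $k$-sphere congruences. Then both nets are determined by these subnets: if discrete curvature line nets $G,\hat G:\Gamma\to S^n$ agree with $F$, resp. $\hat F$, on all of them, then $G=F$ and $\hat G=\hat F$. 3. Let $F,\hat F:\Gamma\to S^n$ be a discrete Ribaucour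 pair of which only $F$ is assumed to be nondegenerate, with $\hat F(t)\ne F(t')$ for all neighbouring $t,t'\in\Gamma$. Then both nets are determined among discrete Ribaucour pairs by their $k$-dimensional subnets through $o$: if a discrete Ribaucour pair $G,\hat G:\Gamma\to S^n$ agrees with $F,\hat F$ on all of them, then $G=F$ and $\hat G=\hat F$. -/

import Mathlib

noncomputable section

namespace CurvatureLineNet

/-- The conformal `n`-sphere, as the unit sphere of Euclidean `(n+1)`-space. -/
abbrev ConformalSphere (n : ℕ) : Type :=
  Metric.sphere (0 : EuclideanSpace ℝ (Fin (n + 1))) 1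

/-- The Lorentz product of the light cone representatives `(p, 1)` and `(q, 1)` of two points of
the conformal sphere. It equals `-|p - q|² / 2`. -/
def lorentz {n : ℕ} (p q : ConformalSphere n) : ℝ :=
  inner ℝ (p : EuclideanSpace ℝ (Fin (n + 1))) (q : EuclideanSpace ℝ (Fin (n + 1))) - 1

/-- The determinant of the Lorentz Gram matrix of four points (it is never positive). -/
def gramDet {n : ℕ} (p : Fin 4 → ConformalSphere n) : ℝ :=
  (Matrix.of fun i j => lorentz (p i) (p j)).det

/-- The complex cross ratio `(p₁ - p₂)(p₃ - p₄) / ((p₂ - p₃)(p₄ - p₁))` of four points of the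
conformal sphere (defined up to complex conjugation, here with a fixed choice of the square root),
`(l₁₂ l₃₄ + l₁₄ l₂₃ - l₁₃ l₂₄ + √(det (lᵢⱼ))) / (2 l₁₄ l₂₃)` with `lᵢⱼ` the Lorentz products;
the square root of the nonpositive determinant is purely imaginary. -/
def crossRatio {n : ℕ} (p₁ p₂ p₃ p₄ : ConformalSphere n) : ℂ :=
  (((lorentz p₁ p₂ * lorentz p₃ p₄ + lorentz p₁ p₄ * lorentz p₂ p₃
      - lorentz p₁ p₃ * lorentz p₂ p₄ : ℝ) : ℂ)
    + Complex.I * ((Real.sqrt (-gramDet ![p₁, p₂, p₃, p₄]) : ℝ) : ℂ))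
  / ((2 * lorentz p₁ p₄ * lorentz p₂ p₃ : ℝ) : ℂ)

/-- Four points have real cross ratio, i.e. they are concircular. (If `p₁ = p₄` or `p₂ = p₃` this
holds by the convention `z / 0 = 0`, in accordance with the fact that the at most three distinct
points are concircular.) -/
def HasRealCrossRatio {n : ℕ} (p₁ p₂ p₃ p₄ : ConformalSphere n) : Prop :=
  (crossRatio p₁ p₂ p₃ p₄).im = 0

/-- The points of `P` lie on a `k`-sphere of the conformal sphere. The `k`-spheres, `k ≤ n`, are the
sections of the unit sphere by `(k+1)`-dimensional affine subspaces that meet it in more than one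
point; so this says that `P` spans an affine subspace of dimension at most `k + 1`. In particular
`k = 1` means concircular, and there is no condition when `k ≥ n`. -/
def LieOnSphere {n : ℕ} (k : ℕ) (P : Set (ConformalSphere n)) : Prop :=
  Module.finrank ℝ (vectorSpan ℝ
    ((fun p : ConformalSphere n => (p : EuclideanSpace ℝ (Fin (n + 1)))) '' P)) ≤ k + 1

/-- On a circle, the point pairs `a, b` and `c, d` separate each other: the four points are distinct
and the chords `ab` and `cd` cross. -/
def Separate {n : ℕ} (a b c d : ConformalSphere n) : Prop :=
  a ≠ c ∧ a ≠ d ∧ b ≠ c ∧ b ≠ d ∧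
    (openSegment ℝ (a : EuclideanSpace ℝ (Fin (n + 1))) b ∩
      openSegment ℝ (c : EuclideanSpace ℝ (Fin (n + 1))) d).Nonempty

/-- The neighbour `t + a tᵢ` of the lattice point `t`, where `tᵢ` is the `i`-th standard direction
vector and `a` is `1` or `-1`. -/
def step {m : ℕ} (t : Fin m → ℤ) (i : Fin m) (a : ℤˣ) : Fin m → ℤ :=
  t + Pi.single i (a : ℤ)

/-- The vertices of the elementary cell with base vertex `t` and set `J` of directions. -/
def cell {m : ℕ} (t : Fin m → ℤ) (J : Finset (Fin m)) : Set (Fin m → ℤ) :=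
  {s | ∀ i, s i = t i ∨ (i ∈ J ∧ s i = t i + 1)}

/-- The part of the lattice `Γ` that passes through `o` in the directions of `J`. -/
def sublattice {m : ℕ} (Γ : Set (Fin m → ℤ)) (o : Fin m → ℤ) (J : Finset (Fin m)) :
    Set (Fin m → ℤ) :=
  {t | t ∈ Γ ∧ ∀ i, i ∉ J → t i = o i}

/-- `F : Γ → Sⁿ` is a discrete curvature line net: the vertices of any elementary quadrilateral
have real cross ratio. (Values of `F` outside `Γ` play no role.) -/
def IsCurvatureLineNet {m n : ℕ} (Γ : Set (Fin m → ℤ)) (F : (Fin m → ℤ) → ConformalSphere n) :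
    Prop :=
  ∀ (t : Fin m → ℤ) (i j : Fin m), i ≠ j → cell t {i, j} ⊆ Γ →
    HasRealCrossRatio (F t) (F (step t i 1)) (F (step (step t i 1) j 1)) (F (step t j 1))

/-- Nondegeneracy of a net: each elementary quadrilateral has four distinct vertices, and the
vertices of an elementary 3-cell do not all lie on one circle. -/
def IsNondegenerate {m n : ℕ} (Γ : Set (Fin m → ℤ)) (F : (Fin m → ℤ) → ConformalSphere n) : Prop :=
  (∀ (t : Fin m → ℤ) (J : Finset (Fin m)), J.card = 2 → cell t J ⊆ Γ → Set.InjOn F (cell t J)) ∧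
  ∀ (t : Fin m → ℤ) (J : Finset (Fin m)), J.card = 3 → cell t J ⊆ Γ →
    ¬ LieOnSphere 1 (F '' cell t J)

/-- The subnets of the discrete curvature line nets `F` and `F'` through `o` in the directions of
`J` envelope a discrete Ribaucour congruence of `k`-spheres, where `k` is the number of elements of
`J`: all corresponding elementary `k`-cells lie on `k`-spheres. -/
def EnvelopeRibaucourCongruence {m n : ℕ} (Γ : Set (Fin m → ℤ)) (o : Fin m → ℤ)
    (J : Finset (Fin m)) (F F' : (Fin m → ℤ) → ConformalSphere n) : Prop :=
  IsCurvatureLineNet (sublattice Γ o J) F ∧ IsCurvatureLineNet (sublattice Γ o J) F' ∧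
  ∀ t : Fin m → ℤ, cell t J ⊆ sublattice Γ o J →
    LieOnSphere J.card (F '' cell t J ∪ F' '' cell t J)

/-- `F` and `F'` form a discrete Ribaucour pair of orthogonal nets: both are discrete curvature line
nets, corresponding points form point pairs, corresponding elementary `k`-cells lie on `k`-spheres
for `1 ≤ k ≤ m`, and corresponding edges do not separate each other on the circles they lie on. Each
of the two nets may degenerate; for instance `F'` may be constant. -/
structure IsRibaucourPair {m n : ℕ} (Γ : Set (Fin m → ℤ))
    (F F' : (Fin m → ℤ) → ConformalSphere n) : Prop where
  left : IsCurvatureLineNet Γ F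
  right : IsCurvatureLineNet Γ F'
  ne : ∀ t ∈ Γ, F t ≠ F' t
  cells : ∀ (t : Fin m → ℤ) (J : Finset (Fin m)), J.Nonempty → cell t J ⊆ Γ →
    LieOnSphere J.card (F '' cell t J ∪ F' '' cell t J)
  not_separate : ∀ (t : Fin m → ℤ) (i : Fin m), t ∈ Γ → step t i 1 ∈ Γ →
    ¬ Separate (F t) (F (step t i 1)) (F' t) (F' (step t i 1))

/-- Two nets agree on all subnets of dimension `k` through `o`. -/
def AgreeOnSubnets {m n : ℕ} (Γ : Set (Fin m → ℤ)) (o : Fin m → ℤ) (k : ℕ)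
    (F G : (Fin m → ℤ) → ConformalSphere n) : Prop :=
  ∀ J : Finset (Fin m), J.card = k → Set.EqOn F G (sublattice Γ o J)

end CurvatureLineNet

end

/-! A real cross ratio means concircularity: the Gram determinant of the light cone representatives
vanishes exactly for affinely dependent points (`hasRealCrossRatio_iff`). The geometry then rests on
one fact: circles with three distinct common points coincide (`LieOnSphere.union`).

In a nondegenerate 3-cell, the circles of the three faces at a vertex `q` are fixed by the other
vertices. If they met in a second point, two of them would coincide; then `q` and its neighbours,
and face by face the whole cell, would be concircular. So `q` is determined
(`IsCurvatureHexahedron.eq_of_concircular`). Vertices differing from `o` in at most two coordinates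
lie in the given subnets since `2 ≤ k`; any other vertex is a corner of a 3-cell whose remaining
vertices are nearer to `o`, and `induction_on_cells` concludes.

For a Ribaucour pair, the first net is determined in this way. The second net at such a vertex lies
on the circles of the three edges joining `q` to its neighbours. These circles already meet in `q`,
and two further common points would again make `q` and its neighbours concircular
(`eq_of_edge_circles`). -/

namespace CurvatureLineNet

/-! ### Circles, Gram determinants and real cross ratios. -/

section Concircular

variable {n : ℕ}

theorem LieOnSphere.mono {k : ℕ} {S T : Set (ConformalSphere n)} (hT : LieOnSphere k T)
    (h : S ⊆ T) : LieOnSphere k S :=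
  (Submodule.finrank_mono (vectorSpan_mono ℝ (Set.image_mono h))).trans hT

/-- Three distinct points of the sphere span an affine plane. -/
theorem finrank_vectorSpan_of_ne {a b c : ConformalSphere n}
    (hab : a ≠ b) (hac : a ≠ c) (hbc : b ≠ c) :
    Module.finrank ℝ (vectorSpan ℝ
      (Set.range ![(a : EuclideanSpace ℝ (Fin (n + 1))), b, c])) = 2 := by
  have h : AffineIndependent ℝ ![(a : EuclideanSpace ℝ (Fin (n + 1))), b, c] := by
    have hc : EuclideanGeometry.Cospherical
        ({(a : EuclideanSpace ℝ (Fin (n + 1))), (b : EuclideanSpace ℝ (Fin (n + 1))),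
          (c : EuclideanSpace ℝ (Fin (n + 1)))} : Set (EuclideanSpace ℝ (Fin (n + 1)))) := by
      refine ⟨0, 1, ?_⟩
      rintro p (rfl | rfl | rfl)
      exacts [a.2, b.2, c.2]
    exact hc.affineIndependent_of_ne (fun h => hab (Subtype.ext h))
      (fun h => hac (Subtype.ext h)) (fun h => hbc (Subtype.ext h))
  exact h.finrank_vectorSpan (by simp)

/-- Two concircular sets with three common points lie on the same circle. -/
theorem LieOnSphere.union {S T : Set (ConformalSphere n)} (hS : LieOnSphere 1 S)
    (hT : LieOnSphere 1 T) {a b c : ConformalSphere n} (haS : a ∈ S) (hbS : b ∈ S) (hcS : c ∈ S)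
    (haT : a ∈ T) (hbT : b ∈ T) (hcT : c ∈ T) (hab : a ≠ b) (hac : a ≠ c) (hbc : b ≠ c) :
    LieOnSphere 1 (S ∪ T) := by
  have h2 := finrank_vectorSpan_of_ne hab hac hbc
  set E := vectorSpan ℝ (Set.range ![(a : EuclideanSpace ℝ (Fin (n + 1))), b, c])
  -- The three points already span the plane of any circle through them, so every such circle has
  -- direction space `E`.
  have key : ∀ U : Set (ConformalSphere n), LieOnSphere 1 U → a ∈ U → b ∈ U → c ∈ U →
      ∀ p ∈ U, (p : EuclideanSpace ℝ (Fin (n + 1))) - a ∈ E := by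
    intro U hU ha hb hc p hp
    have hE : E = vectorSpan ℝ ((fun p : ConformalSphere n =>
        (p : EuclideanSpace ℝ (Fin (n + 1)))) '' U) := by
      refine Submodule.eq_of_le_of_finrank_le (vectorSpan_mono ℝ ?_) (h2 ▸ hU)
      rintro _ ⟨i, rfl⟩
      fin_cases i
      exacts [⟨a, ha, rfl⟩, ⟨b, hb, rfl⟩, ⟨c, hc, rfl⟩]
    rw [hE]
    exact vsub_mem_vectorSpan ℝ ⟨p, hp, rfl⟩ ⟨a, ha, rfl⟩
  have hle : vectorSpan ℝ ((fun p : ConformalSphere n =>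
      (p : EuclideanSpace ℝ (Fin (n + 1)))) '' (S ∪ T)) ≤ E := by
    rw [vectorSpan_eq_span_vsub_set_right ℝ
      (Set.mem_image_of_mem _ (Set.mem_union_left T haS)), Submodule.span_le]
    rintro _ ⟨_, ⟨p, hp, rfl⟩, rfl⟩
    rcases hp with hp | hp
    exacts [key S hS haS hbS hcS p hp, key T hT haT hbT hcT p hp]
  exact (Submodule.finrank_mono hle).trans h2.le

theorem lorentz_eq_dist (p q : ConformalSphere n) : lorentz p q = -(dist p q ^ 2 / 2) := by
  have hp : ‖(p : EuclideanSpace ℝ (Fin (n + 1)))‖ = 1 := by simp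
  have hq : ‖(q : EuclideanSpace ℝ (Fin (n + 1)))‖ = 1 := by simp
  rw [Subtype.dist_eq, dist_eq_norm, @norm_sub_sq_real, hp, hq, lorentz]
  ring

theorem lorentz_eq_zero_iff {p q : ConformalSphere n} : lorentz p q = 0 ↔ p = q := by
  rw [lorentz_eq_dist]
  simp

/-- In the three products of opposite distances, the determinant factors like Heron's formula, and
Ptolemy's inequality is the triangle inequality for these products. The sign makes the square root
in `crossRatio` vanish only when the determinant does. -/
theorem gramDet_nonpos (p : Fin 4 → ConformalSphere n) : gramDet p ≤ 0 := by
  have ptolemy : ∀ a b c d : ConformalSphere n,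
      dist a c * dist b d ≤ dist a b * dist c d + dist b c * dist a d := fun a b c d =>
    EuclideanGeometry.mul_dist_le_mul_dist_add_mul_dist (a : EuclideanSpace ℝ (Fin (n + 1))) b c d
  have h1 := ptolemy (p 0) (p 1) (p 2) (p 3)
  have h2 := ptolemy (p 0) (p 2) (p 1) (p 3)
  have h3 := ptolemy (p 0) (p 1) (p 3) (p 2)
  simp only [dist_comm (p 2) (p 1), dist_comm (p 3) (p 2)] at h1 h2 h3
  have e : gramDet p = -((dist (p 0) (p 1) * dist (p 2) (p 3) + dist (p 0) (p 2) * dist (p 1) (p 3)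
        + dist (p 0) (p 3) * dist (p 1) (p 2)) *
      (dist (p 0) (p 1) * dist (p 2) (p 3) + dist (p 1) (p 2) * dist (p 0) (p 3)
        - dist (p 0) (p 2) * dist (p 1) (p 3)) *
      (dist (p 0) (p 2) * dist (p 1) (p 3) + dist (p 1) (p 2) * dist (p 0) (p 3)
        - dist (p 0) (p 1) * dist (p 2) (p 3)) *
      (dist (p 0) (p 1) * dist (p 2) (p 3) + dist (p 1) (p 3) * dist (p 0) (p 2)
        - dist (p 0) (p 3) * dist (p 1) (p 2))) / 16 := by
    simp only [gramDet, Matrix.det_succ_row_zero, Fin.sum_univ_succ, lorentz_eq_dist]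
    simp [Fin.succAbove, dist_comm (p 2) (p 1), dist_comm (p 3) (p 2), dist_comm (p 3) (p 1),
      dist_comm (p 1) (p 0), dist_comm (p 2) (p 0), dist_comm (p 3) (p 0)]
    ring
  rw [e]
  have : 0 ≤ (dist (p 0) (p 1) * dist (p 2) (p 3) + dist (p 0) (p 2) * dist (p 1) (p 3)
        + dist (p 0) (p 3) * dist (p 1) (p 2)) *
      (dist (p 0) (p 1) * dist (p 2) (p 3) + dist (p 1) (p 2) * dist (p 0) (p 3)
        - dist (p 0) (p 2) * dist (p 1) (p 3)) *
      (dist (p 0) (p 2) * dist (p 1) (p 3) + dist (p 1) (p 2) * dist (p 0) (p 3)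
        - dist (p 0) (p 1) * dist (p 2) (p 3)) *
      (dist (p 0) (p 1) * dist (p 2) (p 3) + dist (p 1) (p 3) * dist (p 0) (p 2)
        - dist (p 0) (p 3) * dist (p 1) (p 2)) :=
    mul_nonneg (mul_nonneg (mul_nonneg (by positivity) (by linarith)) (by linarith)) (by linarith)
  linarith

/-- The Gram determinant of the light cone representatives vanishes if and only if the points are
affinely dependent. -/
theorem gramDet_eq_zero_iff (p : Fin 4 → ConformalSphere n) :
    gramDet p = 0 ↔
      ¬ AffineIndependent ℝ fun i => (p i : EuclideanSpace ℝ (Fin (n + 1))) := by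
  have hmul : ∀ (w : Fin 4 → ℝ) (i : Fin 4),
      (Matrix.of fun i j => lorentz (p i) (p j)).mulVec w i =
        inner ℝ (p i : EuclideanSpace ℝ (Fin (n + 1)))
          (∑ j, w j • (p j : EuclideanSpace ℝ (Fin (n + 1)))) - ∑ j, w j := by
    intro w i
    simp only [Matrix.mulVec, dotProduct, Matrix.of_apply, lorentz, inner_sum, inner_smul_right]
    rw [← Finset.sum_sub_distrib]
    exact Finset.sum_congr rfl fun j _ => by ring
  have hp : ∀ i, ‖(p i : EuclideanSpace ℝ (Fin (n + 1)))‖ = 1 := fun i => by simp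
  rw [gramDet, ← Matrix.exists_mulVec_eq_zero_iff]
  constructor
  -- A kernel vector `w` makes `(v, s)` Lorentz orthogonal to every `(pᵢ, 1)`, hence also to itself.
  -- Orthogonal lightlike vectors are proportional, so `v = s pᵢ` for all `i`; as the `pᵢ` are
  -- distinct, `s = 0` and `v = 0`, an affine dependence.
  · rintro ⟨w, hw0, hw⟩ hi
    set v := ∑ j, w j • (p j : EuclideanSpace ℝ (Fin (n + 1))) with hv
    set s := ∑ j, w j with hs
    have hinner : ∀ i, inner ℝ (p i : EuclideanSpace ℝ (Fin (n + 1))) v = s := fun i =>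
      sub_eq_zero.1 ((hmul w i).symm.trans (congrFun hw i))
    have hvv : ‖v‖ ^ 2 = s ^ 2 := by
      rw [← real_inner_self_eq_norm_sq]
      nth_rewrite 1 [hv]
      simp only [sum_inner, real_inner_smul_left, hinner]
      rw [← Finset.sum_mul, ← hs, sq]
    have hvp : ∀ i, v = s • (p i : EuclideanSpace ℝ (Fin (n + 1))) := by
      intro i
      rw [← sub_eq_zero, ← norm_eq_zero, ← sq_eq_zero_iff, @norm_sub_sq_real, hvv,
        real_inner_smul_right, real_inner_comm, hinner, norm_smul, hp, Real.norm_eq_abs, mul_one,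
        sq_abs]
      ring
    have hs0 : s = 0 := by
      by_contra h
      have : (p 0 : EuclideanSpace ℝ (Fin (n + 1))) = p 1 :=
        smul_right_injective _ h ((hvp 0).symm.trans (hvp 1))
      exact absurd (hi.injective this) (by decide)
    have hv0 : v = 0 := by rw [hvp 0, hs0, zero_smul]
    refine hw0 (funext fun i => ?_)
    exact (affineIndependent_iff.1 hi) Finset.univ w hs0 hv0 i (Finset.mem_univ i)
  · intro h
    rw [affineIndependent_iff_of_fintype] at h
    push Not at h
    obtain ⟨w, hs, hv, i, hi⟩ := h
    refine ⟨w, fun h => hi (congrFun h i), funext fun i => ?_⟩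
    rw [Finset.univ.weightedVSub_eq_linear_combination hs] at hv
    rw [hmul, hv, hs]
    simp

/-- A real cross ratio characterizes concircular points. -/
theorem hasRealCrossRatio_iff {a b c d : ConformalSphere n} :
    HasRealCrossRatio a b c d ↔ LieOnSphere 1 {a, b, c, d} := by
  have hsphere : gramDet ![a, b, c, d] = 0 ↔ LieOnSphere 1 {a, b, c, d} := by
    rw [gramDet_eq_zero_iff, ← finrank_vectorSpan_le_iff_not_affineIndependent ℝ _
      (show Fintype.card (Fin 4) = 2 + 2 from rfl), LieOnSphere]
    have : (Set.range fun i => (![a, b, c, d] i : EuclideanSpace ℝ (Fin (n + 1)))) =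
        (fun p : ConformalSphere n => (p : EuclideanSpace ℝ (Fin (n + 1)))) '' {a, b, c, d} := by
      rw [Set.range_comp' Subtype.val]
      congr 1
      ext
      simp [Matrix.range_cons, Matrix.range_empty]
      tauto
    rw [this]
  rw [← hsphere]
  have him : (crossRatio a b c d).im =
      Real.sqrt (-gramDet ![a, b, c, d]) / (2 * lorentz a d * lorentz b c) := by
    rw [crossRatio, Complex.div_ofReal_im]
    simp
  rw [HasRealCrossRatio, him, div_eq_zero_iff, Real.sqrt_eq_zero (by
    linarith [gramDet_nonpos ![a, b, c, d]]), neg_eq_zero]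
  -- If the denominator vanishes, two of the points coincide and the Gram determinant is zero
  -- anyway.
  refine or_iff_left_of_imp fun h => ?_
  rw [gramDet_eq_zero_iff]
  intro hi
  simp only [mul_eq_zero, OfNat.ofNat_ne_zero, false_or, lorentz_eq_zero_iff] at h
  rcases h with rfl | rfl
  · exact absurd (hi.injective (a₁ := 0) (a₂ := 3) rfl) (by decide)
  · exact absurd (hi.injective (a₁ := 1) (a₂ := 2) rfl) (by decide)

end Concircular

/-! ### The geometry of a single nondegenerate 3-cell. -/

section Hexahedron

variable {n : ℕ}

/-- The vertices of a nondegenerate elementary 3-cell of a discrete curvature line net: `p₀` has the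
neighbours `pᵢ`, and `q` is opposite to `p₀`. Only the circles and inequalities that are relevant
for the reconstruction of `q` are recorded. -/
structure IsCurvatureHexahedron (p₀ p₁ p₂ p₃ p₁₂ p₁₃ p₂₃ q : ConformalSphere n) : Prop where
  face₁ : LieOnSphere 1 {p₁, p₁₂, p₁₃, q}
  face₂ : LieOnSphere 1 {p₂, p₁₂, p₂₃, q}
  face₃ : LieOnSphere 1 {p₃, p₁₃, p₂₃, q}
  face₀ : LieOnSphere 1 {p₀, p₁, p₂, p₁₂}
  inj₁ : [p₁, p₁₂, p₁₃, q].Nodup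
  inj₂ : [p₂, p₁₂, p₂₃, q].Nodup
  inj₃ : [p₃, p₁₃, p₂₃, q].Nodup
  inj₀ : [p₀, p₁, p₂, p₁₂].Nodup
  not_concircular : ¬ LieOnSphere 1 {p₀, p₁, p₂, p₃, p₁₂, p₁₃, p₂₃, q}

namespace IsCurvatureHexahedron

variable {p₀ p₁ p₂ p₃ p₁₂ p₁₃ p₂₃ q : ConformalSphere n}

/-- A vertex and its three neighbours are not concircular. -/
theorem not_lieOnSphere (h : IsCurvatureHexahedron p₀ p₁ p₂ p₃ p₁₂ p₁₃ p₂₃ q)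
    {S : Set (ConformalSphere n)} (h₁₂ : p₁₂ ∈ S) (h₁₃ : p₁₃ ∈ S) (h₂₃ : p₂₃ ∈ S) (hq : q ∈ S) :
    ¬ LieOnSphere 1 S := by
  intro hS
  have i₁ := h.inj₁
  have i₂ := h.inj₂
  have i₃ := h.inj₃
  have i₀ := h.inj₀
  simp only [List.nodup_cons, List.mem_cons, List.not_mem_nil, or_false, not_or] at i₁ i₂ i₃ i₀
  -- Each face has three vertices on the circle obtained so far; the four faces add `p₁`, `p₂`, `p₃`
  -- and finally `p₀`.
  have s₁ := hS.union h.face₁ h₁₂ h₁₃ hq (by simp) (by simp) (by simp) (by tauto) (by tauto)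
    (by tauto)
  have s₂ := s₁.union h.face₂ (a := p₁₂) (b := p₂₃) (c := q) (by simp) (by simp [h₂₃]) (by simp)
    (by simp) (by simp) (by simp) (by tauto) (by tauto) (by tauto)
  have s₃ := s₂.union h.face₃ (a := p₁₃) (b := p₂₃) (c := q) (by simp) (by simp) (by simp)
    (by simp) (by simp) (by simp) (by tauto) (by tauto) (by tauto)
  have s₀ := s₃.union h.face₀ (a := p₁) (b := p₂) (c := p₁₂) (by simp) (by simp) (by simp)
    (by simp) (by simp) (by simp) (by tauto) (by tauto) (by tauto)
  refine h.not_concircular (s₀.mono ?_)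
  rintro x (rfl | rfl | rfl | rfl | rfl | rfl | rfl | rfl) <;> simp

/-- The vertex opposite to `p₀` is the only common point of the three circles that it lies on. -/
theorem eq_of_concircular (h : IsCurvatureHexahedron p₀ p₁ p₂ p₃ p₁₂ p₁₃ p₂₃ q)
    {x : ConformalSphere n} (h₁ : LieOnSphere 1 {p₁, p₁₂, p₁₃, x})
    (h₂ : LieOnSphere 1 {p₂, p₁₂, p₂₃, x}) (h₃ : LieOnSphere 1 {p₃, p₁₃, p₂₃, x}) : x = q := by
  by_contra hx
  have i₁ := h.inj₁
  have i₂ := h.inj₂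
  have i₃ := h.inj₃
  simp only [List.nodup_cons, List.mem_cons, List.not_mem_nil, or_false, not_or] at i₁ i₂ i₃
  have s₁ := h₁.union h.face₁ (a := p₁) (b := p₁₂) (c := p₁₃) (by simp) (by simp) (by simp)
    (by simp) (by simp) (by simp) (by tauto) (by tauto) (by tauto)
  have s₂ := h₂.union h.face₂ (a := p₂) (b := p₁₂) (c := p₂₃) (by simp) (by simp) (by simp)
    (by simp) (by simp) (by simp) (by tauto) (by tauto) (by tauto)
  have s₃ := h₃.union h.face₃ (a := p₃) (b := p₁₃) (c := p₂₃) (by simp) (by simp) (by simp)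
    (by simp) (by simp) (by simp) (by tauto) (by tauto) (by tauto)
  -- Two of the circles share `q`, `x` and a neighbour of `q`. If that neighbour is `x` itself,
  -- another pair of circles is used; `p₁₂` and `p₁₃` cannot both equal `x`.
  by_cases e₁₂ : p₁₂ = x
  · have e₁₃ : p₁₃ ≠ x := fun e => i₁.2.1.1 (e₁₂.trans e.symm)
    exact h.not_lieOnSphere (by simp) (by simp) (by simp) (by simp)
      (s₁.union s₃ (a := p₁₃) (b := q) (c := x) (by simp) (by simp) (by simp) (by simp) (by simp)
        (by simp) (by tauto) e₁₃ (Ne.symm hx))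
  · exact h.not_lieOnSphere (by simp) (by simp) (by simp) (by simp)
      (s₁.union s₂ (a := p₁₂) (b := q) (c := x) (by simp) (by simp) (by simp) (by simp) (by simp)
        (by simp) (by tauto) e₁₂ (Ne.symm hx))

/-- Circles through `q` and its three neighbours have at most one further common point. -/
theorem eq_of_edge_circles (h : IsCurvatureHexahedron p₀ p₁ p₂ p₃ p₁₂ p₁₃ p₂₃ q)
    {r₁ r₂ r₃ x y : ConformalSphere n} (hx : x ≠ q) (hy : y ≠ q)
    (h₁ : r₁ ≠ p₂₃) (h₂ : r₂ ≠ p₁₃) (h₃ : r₃ ≠ p₁₂) (hq₁ : r₁ ≠ q) (hq₂ : r₂ ≠ q) (hq₃ : r₃ ≠ q)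
    (x₁ : LieOnSphere 1 {p₂₃, q, r₁, x}) (x₂ : LieOnSphere 1 {p₁₃, q, r₂, x})
    (x₃ : LieOnSphere 1 {p₁₂, q, r₃, x}) (y₁ : LieOnSphere 1 {p₂₃, q, r₁, y})
    (y₂ : LieOnSphere 1 {p₁₃, q, r₂, y}) (y₃ : LieOnSphere 1 {p₁₂, q, r₃, y}) : x = y := by
  by_contra hxy
  have i₁ := h.inj₁
  have i₂ := h.inj₂
  simp only [List.nodup_cons, List.mem_cons, List.not_mem_nil, or_false, not_or] at i₁ i₂
  have s₁ := x₁.union y₁ (a := p₂₃) (b := q) (c := r₁) (by simp) (by simp) (by simp)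
    (by simp) (by simp) (by simp) (by tauto) h₁.symm hq₁.symm
  have s₂ := x₂.union y₂ (a := p₁₃) (b := q) (c := r₂) (by simp) (by simp) (by simp)
    (by simp) (by simp) (by simp) (by tauto) h₂.symm hq₂.symm
  have s₃ := x₃.union y₃ (a := p₁₂) (b := q) (c := r₃) (by simp) (by simp) (by simp)
    (by simp) (by simp) (by simp) (by tauto) h₃.symm hq₃.symm
  -- The three circles now share the distinct points `q`, `x`, `y`, so they are one circle
  -- containing `q` and its neighbours.
  have s₁₂ := s₁.union s₂ (a := q) (b := x) (c := y) (by simp) (by simp) (by simp)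
    (by simp) (by simp) (by simp) hx.symm hy.symm hxy
  exact h.not_lieOnSphere (by simp) (by simp) (by simp) (by simp)
    (s₁₂.union s₃ (a := q) (b := x) (c := y) (by simp) (by simp) (by simp)
      (by simp) (by simp) (by simp) hx.symm hy.symm hxy)

end IsCurvatureHexahedron

end Hexahedron

/-! ### Elementary cells with steps of either sign. -/

section Lattice

variable {m n : ℕ}

theorem step_apply (t : Fin m → ℤ) (i : Fin m) (a : ℤˣ) (x : Fin m) :
    step t i a x = t x + if x = i then (a : ℤ) else 0 := by
  simp [step, Pi.single_apply]

theorem step_comm (t : Fin m → ℤ) (i j : Fin m) (a b : ℤˣ) :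
    step (step t i a) j b = step (step t j b) i a :=
  add_right_comm _ _ _

/-- The vertices of the cell with opposite vertices `t` and `u`. -/
def box (t u : Fin m → ℤ) : Set (Fin m → ℤ) :=
  {s | ∀ i, s i = t i ∨ s i = u i}

theorem box_subset {I : Fin m → Set ℤ} {t u : Fin m → ℤ} (ht : t ∈ Set.univ.pi I)
    (hu : u ∈ Set.univ.pi I) : box t u ⊆ Set.univ.pi I := by
  intro s hs i _
  rcases hs i with h | h <;> rw [h]
  exacts [ht i trivial, hu i trivial]

/-- `cell` starts from the lowest corner, while the induction approaches `o` from any side; the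
coordinatewise minimum of two opposite corners is that lowest corner. -/
theorem exists_cell_eq_box {t u : Fin m → ℤ} {J : Finset (Fin m)}
    (h : ∀ i ∈ J, u i = t i + 1 ∨ u i = t i - 1) (h' : ∀ i ∉ J, u i = t i) :
    ∃ s, cell s J = box t u := by
  refine ⟨fun i => min (t i) (u i), Set.ext fun r => forall_congr' fun i => ?_⟩
  by_cases hi : i ∈ J
  · rcases h i hi with h | h <;> simp only [hi, true_and] <;> omega
  · simp [hi, h' i hi]

theorem int_units_cases (t : ℤ) (a : ℤˣ) : t + a = t + 1 ∨ t + a = t - 1 := by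
  rcases Int.units_eq_one_or a with rfl | rfl <;> simp [sub_eq_add_neg]

theorem exists_cell_eq_box_one (t : Fin m → ℤ) (i : Fin m) (a : ℤˣ) :
    ∃ s, cell s {i} = box t (step t i a) := by
  refine exists_cell_eq_box (fun x hx => ?_) fun x hx => ?_
  · obtain rfl := Finset.mem_singleton.1 hx
    simpa [step_apply] using int_units_cases (t x) a
  · simp_all [step_apply]

theorem exists_cell_eq_box_two (t : Fin m → ℤ) {i j : Fin m} (hij : i ≠ j) (a b : ℤˣ) :
    ∃ s, cell s {i, j} = box t (step (step t i a) j b) := by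
  refine exists_cell_eq_box (fun x hx => ?_) fun x hx => ?_
  · simp only [Finset.mem_insert, Finset.mem_singleton] at hx
    rcases hx with rfl | rfl
    · simpa [step_apply, hij] using int_units_cases (t x) a
    · simpa [step_apply, hij.symm] using int_units_cases (t x) b
  · simp_all [step_apply]

theorem exists_cell_eq_box_three (t : Fin m → ℤ) {i j l : Fin m} (hij : i ≠ j) (hil : i ≠ l)
    (hjl : j ≠ l) (a b c : ℤˣ) :
    ∃ s, cell s {i, j, l} = box t (step (step (step t i a) j b) l c) := by
  refine exists_cell_eq_box (fun x hx => ?_) fun x hx => ?_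
  · simp only [Finset.mem_insert, Finset.mem_singleton] at hx
    rcases hx with rfl | rfl | rfl
    · simpa [step_apply, hij, hil] using int_units_cases (t x) a
    · simpa [step_apply, hij.symm, hjl] using int_units_cases (t x) b
    · simpa [step_apply, hil.symm, hjl.symm] using int_units_cases (t x) c
  · simp_all [step_apply]

theorem box_self (t : Fin m → ℤ) : box t t = {t} := by
  ext r
  simp [box, funext_iff]

/-- Adding one direction doubles the cell; iterating this lists the vertices of edges,
quadrilaterals and 3-cells. -/
theorem box_step (t : Fin m → ℤ) (i : Fin m) (a : ℤˣ) (u : Fin m → ℤ) (hu : u i = t i) :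
    box t (step u i a) = box t u ∪ (fun r => step r i a) '' box t u := by
  ext r
  constructor
  · intro hr
    rcases hr i with h | h
    · refine Or.inl fun x => ?_
      by_cases hx : x = i
      · exact Or.inl (hx ▸ h)
      · simpa [step_apply, hx] using hr x
    · refine Or.inr ⟨step r i (-a), fun x => ?_, ?_⟩
      · by_cases hx : x = i
        · subst hx
          left
          simp [step_apply, h, hu]
        · simpa [step_apply, hx] using hr x
      · ext x
        by_cases hx : x = i <;> simp [step_apply, hx]
  · rintro (hr | ⟨r, hr, rfl⟩) x
    · by_cases hx : x = i
      · subst hx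
        exact Or.inl ((hr x).elim id fun h => h.trans hu)
      · simpa [step_apply, hx] using hr x
    · by_cases hx : x = i
      · subst hx
        have := (hr x).elim id fun h => h.trans hu
        exact Or.inr (by simp [step_apply, this, hu])
      · simpa [step_apply, hx] using hr x

theorem box_one (t : Fin m → ℤ) (i : Fin m) (a : ℤˣ) :
    box t (step t i a) = {t, step t i a} := by
  rw [box_step t i a t rfl, box_self, Set.image_singleton]
  rfl

theorem box_two (t : Fin m → ℤ) {i j : Fin m} (hij : i ≠ j) (a b : ℤˣ) :
    box t (step (step t i a) j b) =
      {t, step t i a, step t j b, step (step t i a) j b} := by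
  rw [box_step t j b _ (by simp [step_apply, hij.symm]), box_one, Set.image_pair]
  ext
  simp only [Set.mem_union, Set.mem_insert_iff, Set.mem_singleton_iff]
  tauto

theorem box_three (t : Fin m → ℤ) {i j l : Fin m} (hij : i ≠ j) (hil : i ≠ l) (hjl : j ≠ l)
    (a b c : ℤˣ) :
    box t (step (step (step t i a) j b) l c) =
      {t, step t i a, step t j b, step t l c, step (step t i a) j b, step (step t i a) l c,
        step (step t j b) l c, step (step (step t i a) j b) l c} := by
  rw [box_step t l c _ (by simp [step_apply, hil.symm, hjl.symm]), box_two t hij]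
  ext
  simp only [Set.image_insert_eq, Set.image_singleton, Set.mem_union, Set.mem_insert_iff,
    Set.mem_singleton_iff]
  tauto

/-! ### Circles and nondegeneracy for cells of nets on a product of intervals. -/

variable {I : Fin m → Set ℤ} {F F' G G' : (Fin m → ℤ) → ConformalSphere n}

theorem IsCurvatureLineNet.lieOnSphere_face (hF : IsCurvatureLineNet (Set.univ.pi I) F)
    {t : Fin m → ℤ} {i j : Fin m} (hij : i ≠ j) {a b : ℤˣ} (ht : t ∈ Set.univ.pi I)
    (hu : step (step t i a) j b ∈ Set.univ.pi I) :
    LieOnSphere 1 {F t, F (step t i a), F (step t j b), F (step (step t i a) j b)} := by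
  obtain ⟨s, hs⟩ := exists_cell_eq_box_two t hij a b
  -- The cross ratio lists the vertices cyclically, `box_two` does not; passing to vertex sets
  -- removes the difference.
  have hs' : cell s {i, j} = {s, step s i 1, step s j 1, step (step s i 1) j 1} := by
    rw [← box_two s hij]
    refine Set.ext fun r => forall_congr' fun x => ?_
    by_cases h1 : x = i
    · subst h1
      simp [step_apply, hij]
    · by_cases h2 : x = j
      · subst h2
        simp [step_apply, h1]
      · simp [step_apply, h1, h2]
  have := hasRealCrossRatio_iff.1 (hF s i j hij (hs ▸ box_subset ht hu))
  have key : LieOnSphere 1 (F '' cell s {i, j}) := by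
    refine this.mono ?_
    rw [hs']
    simp only [Set.image_insert_eq, Set.image_singleton]
    rintro x (rfl | rfl | rfl | rfl) <;> simp
  rw [hs, box_two t hij] at key
  simpa only [Set.image_insert_eq, Set.image_singleton] using key

theorem IsNondegenerate.nodup_face (hF : IsNondegenerate (Set.univ.pi I) F)
    {t : Fin m → ℤ} {i j : Fin m} (hij : i ≠ j) {a b : ℤˣ} (ht : t ∈ Set.univ.pi I)
    (hu : step (step t i a) j b ∈ Set.univ.pi I) :
    [F t, F (step t i a), F (step t j b), F (step (step t i a) j b)].Nodup := by
  obtain ⟨s, hs⟩ := exists_cell_eq_box_two t hij a b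
  have key := hF.1 s {i, j} (Finset.card_pair hij) (hs ▸ box_subset ht hu)
  rw [hs, box_two t hij] at key
  have hne : [t, step t i a, step t j b, step (step t i a) j b].Nodup := by
    have hi : ∀ u : Fin m → ℤ, step u i a i ≠ u i := fun u => by simp [step_apply]
    have hj : ∀ u : Fin m → ℤ, step u j b j ≠ u j := fun u => by simp [step_apply]
    have h1 : t ≠ step t i a := fun h => hi t (congrFun h i).symm
    have h2 : t ≠ step t j b := fun h => hj t (congrFun h j).symm
    have h3 : t ≠ step (step t i a) j b := fun h => hj t (by
      simpa [step_apply, hij.symm] using (congrFun h j).symm)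
    have h4 : step t i a ≠ step t j b := fun h => hi t (by
      simpa [step_apply, hij] using congrFun h i)
    have h5 : step t i a ≠ step (step t i a) j b := fun h => hj _ (congrFun h j).symm
    have h6 : step t j b ≠ step (step t i a) j b := fun h => hi (step t j b) (by
      rw [step_comm]; exact (congrFun h i).symm)
    simp [h1, h2, h3, h4, h5, h6]
  refine List.Nodup.map_on (f := F) (fun x hx y hy h => key ?_ ?_ h) hne
  · simpa using hx
  · simpa using hy

theorem IsCurvatureLineNet.isCurvatureHexahedron (hF : IsCurvatureLineNet (Set.univ.pi I) F)
    (hF' : IsNondegenerate (Set.univ.pi I) F) {t : Fin m → ℤ} {i j l : Fin m} (hij : i ≠ j)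
    (hil : i ≠ l) (hjl : j ≠ l) {a b c : ℤˣ} (ht : t ∈ Set.univ.pi I)
    (hu : step (step (step t i a) j b) l c ∈ Set.univ.pi I) :
    IsCurvatureHexahedron (F t) (F (step t i a)) (F (step t j b)) (F (step t l c))
      (F (step (step t i a) j b)) (F (step (step t i a) l c)) (F (step (step t j b) l c))
      (F (step (step (step t i a) j b) l c)) := by
  have hbox := box_subset ht hu
  have hb3 := box_three t hij hil hjl a b c
  rw [hb3] at hbox
  simp only [Set.insert_subset_iff, Set.singleton_subset_iff] at hbox
  obtain ⟨-, hi, hj, hl, h12, -, -, -⟩ := hbox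
  have e₂ : step (step (step t j b) i a) l c = step (step (step t i a) j b) l c := by
    rw [step_comm t j i]
  have e₃ : step (step (step t l c) i a) j b = step (step (step t i a) j b) l c := by
    rw [step_comm t l i, step_comm _ l j]
  have f₂ := hF.lieOnSphere_face (a := a) (b := c) hil hj (e₂ ▸ hu)
  have f₃ := hF.lieOnSphere_face (a := a) (b := b) hij hl (e₃ ▸ hu)
  have n₂ := hF'.nodup_face (a := a) (b := c) hil hj (e₂ ▸ hu)
  have n₃ := hF'.nodup_face (a := a) (b := b) hij hl (e₃ ▸ hu)
  rw [e₂, step_comm t j i] at f₂ n₂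
  rw [e₃, step_comm t l i, step_comm t l j] at f₃ n₃
  refine ⟨hF.lieOnSphere_face hjl hi hu, f₂, f₃, hF.lieOnSphere_face hij ht h12,
    hF'.nodup_face hjl hi hu, n₂, n₃, hF'.nodup_face hij ht h12, ?_⟩
  obtain ⟨s, hs⟩ := exists_cell_eq_box_three t hij hil hjl a b c
  have key := hF'.2 s {i, j, l} (Finset.card_eq_three.2 ⟨i, j, l, hij, hil, hjl, rfl⟩)
    (hs ▸ box_subset ht hu)
  rw [hs, hb3] at key
  simpa only [Set.image_insert_eq, Set.image_singleton] using key

theorem IsRibaucourPair.lieOnSphere_edge (h : IsRibaucourPair (Set.univ.pi I) F F')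
    {t : Fin m → ℤ} {i : Fin m} {a : ℤˣ} (ht : t ∈ Set.univ.pi I)
    (hu : step t i a ∈ Set.univ.pi I) :
    LieOnSphere 1 {F t, F (step t i a), F' t, F' (step t i a)} := by
  obtain ⟨s, hs⟩ := exists_cell_eq_box_one t i a
  have key := h.cells s {i} (Finset.singleton_nonempty i) (hs ▸ box_subset ht hu)
  rw [hs, box_one, Finset.card_singleton] at key
  refine key.mono ?_
  rintro x (rfl | rfl | rfl | rfl) <;> simp

/-- The opposite vertex of a 3-cell of a curvature line net, characterized by three circles. -/
theorem eq_opposite_iff (hF : IsCurvatureLineNet (Set.univ.pi I) F)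
    (hF' : IsNondegenerate (Set.univ.pi I) F) {t : Fin m → ℤ} {i j l : Fin m} (hij : i ≠ j)
    (hil : i ≠ l) (hjl : j ≠ l) {a b c : ℤˣ} (ht : t ∈ Set.univ.pi I)
    (hu : step (step (step t i a) j b) l c ∈ Set.univ.pi I) (x : ConformalSphere n) :
    x = F (step (step (step t i a) j b) l c) ↔
      LieOnSphere 1 {F (step t i a), F (step (step t i a) j b), F (step (step t i a) l c), x} ∧
      LieOnSphere 1 {F (step t j b), F (step (step t i a) j b), F (step (step t j b) l c), x} ∧
      LieOnSphere 1 {F (step t l c), F (step (step t i a) l c), F (step (step t j b) l c), x} := by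
  have h := hF.isCurvatureHexahedron hF' hij hil hjl ht hu
  refine ⟨?_, fun hx => h.eq_of_concircular hx.1 hx.2.1 hx.2.2⟩
  rintro rfl
  exact ⟨h.face₁, h.face₂, h.face₃⟩

/-! ### Propagation from the subnets through `o` to the whole lattice. -/

/-- A set of lattice points that contains the points differing from `o` in at most two coordinates
and that contains a vertex of a 3-cell whenever it contains the six vertices of the cell other than
this vertex and the opposite one is everything. -/
theorem induction_on_cells (hI : ∀ i, (I i).OrdConnected) {o : Fin m → ℤ}
    (ho : o ∈ Set.univ.pi I) {P : (Fin m → ℤ) → Prop}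
    (hbase : ∀ t ∈ Set.univ.pi I, (Finset.univ.filter fun i => t i ≠ o i).card ≤ 2 → P t)
    (hstep : ∀ (t : Fin m → ℤ) (i j l : Fin m) (a b c : ℤˣ), i ≠ j → i ≠ l → j ≠ l →
      t ∈ Set.univ.pi I → step (step (step t i a) j b) l c ∈ Set.univ.pi I →
      P (step t i a) → P (step t j b) → P (step t l c) → P (step (step t i a) j b) →
      P (step (step t i a) l c) → P (step (step t j b) l c) → P (step (step (step t i a) j b) l c))
    {t : Fin m → ℤ} (ht : t ∈ Set.univ.pi I) : P t := by
  -- The induction is on the `ℓ¹` distance from `o`.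
  induction hd : ∑ x, (t x - o x).natAbs using Nat.strong_induction_on generalizing t with
  | _ d ih =>
  subst hd
  by_cases hc : (Finset.univ.filter fun i => t i ≠ o i).card ≤ 2
  · exact hbase t ht hc
  obtain ⟨i, hi, j, hj, l, hl, hij, hil, hjl⟩ := Finset.two_lt_card.1 (not_le.1 hc)
  simp only [Finset.mem_filter, Finset.mem_univ, true_and] at hi hj hl
  -- The sign `a` points away from `o`, so subtracting it moves closer; order connectedness keeps
  -- the new coordinate in the interval.
  have toward : ∀ x, t x ≠ o x → ∃ a : ℤˣ, (t x - a - o x).natAbs < (t x - o x).natAbs ∧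
      t x - a ∈ I x := by
    intro x hx
    rcases lt_or_gt_of_ne hx with h | h
    · refine ⟨-1, ?_, (hI x).out (ht x trivial) (ho x trivial) ?_⟩
      · push_cast; omega
      · constructor <;> push_cast <;> omega
    · refine ⟨1, ?_, (hI x).out (ho x trivial) (ht x trivial) ?_⟩
      · push_cast; omega
      · constructor <;> push_cast <;> omega
  obtain ⟨a, ha, haI⟩ := toward i hi
  obtain ⟨b, hb, hbI⟩ := toward j hj
  obtain ⟨c, hc, hcI⟩ := toward l hl
  set s := step (step (step t i (-a)) j (-b)) l (-c) with hs
  have hst : step (step (step s i a) j b) l c = t := by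
    ext x
    simp only [hs, step_apply]
    push_cast
    split_ifs <;> ring
  have hsi : s i = t i - a := by simp [hs, step_apply, hij, hil, sub_eq_add_neg]
  have hsj : s j = t j - b := by simp [hs, step_apply, hij.symm, hjl, sub_eq_add_neg]
  have hsl : s l = t l - c := by simp [hs, step_apply, hil.symm, hjl.symm, sub_eq_add_neg]
  have hsx : ∀ x, x ≠ i → x ≠ j → x ≠ l → s x = t x := fun x h1 h2 h3 => by
    simp [hs, step_apply, h1, h2, h3]
  have hsI : s ∈ Set.univ.pi I ∧
      ∀ x, s x = t x ∨ (s x - o x).natAbs < (t x - o x).natAbs := by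
    refine ⟨fun x _ => ?_, fun x => ?_⟩
    all_goals
      by_cases h1 : x = i
      · subst h1; rw [hsi]; first | exact haI | exact Or.inr ha
      by_cases h2 : x = j
      · subst h2; rw [hsj]; first | exact hbI | exact Or.inr hb
      by_cases h3 : x = l
      · subst h3; rw [hsl]; first | exact hcI | exact Or.inr hc
      rw [hsx x h1 h2 h3]
      first | exact ht x trivial | exact Or.inl rfl
  rw [← hst]
  have hcell : ∀ r ∈ box s t, r ≠ t → P r := by
    intro r hr hrt
    refine ih _ ?_ (box_subset hsI.1 ht hr) rfl
    -- Every coordinate of a cell vertex agrees with that of `t` or is strictly closer to `o`, so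
    -- any vertex other than `t` has smaller distance.
    have hle : ∀ x, r x = t x ∨ (r x - o x).natAbs < (t x - o x).natAbs := fun x =>
      (hr x).elim (fun h => h ▸ hsI.2 x) Or.inl
    obtain ⟨x, hx⟩ := Function.ne_iff.1 hrt
    exact Finset.sum_lt_sum (fun y _ => (hle y).elim (fun h => h ▸ le_rfl) le_of_lt)
      ⟨x, Finset.mem_univ x, (hle x).resolve_left hx⟩
  rw [← hst, box_three s hij hil hjl] at hcell
  refine hstep s i j l a b c hij hil hjl hsI.1 (hst ▸ ht) ?_ ?_ ?_ ?_ ?_ ?_ <;>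
    refine hcell _ (by simp) fun h => ?_
  · simpa [step_apply, hil.symm, hjl.symm] using congrFun h l
  · simpa [step_apply, hil.symm, hjl.symm] using congrFun h l
  · simpa [step_apply, hij.symm, hjl] using congrFun h j
  · simpa [step_apply, hil.symm, hjl.symm] using congrFun h l
  · simpa [step_apply, hij.symm, hjl] using congrFun h j
  · simpa [step_apply, hij, hil] using congrFun h i

theorem AgreeOnSubnets.eq_of_card_le {Γ : Set (Fin m → ℤ)} {o t : Fin m → ℤ} {k : ℕ}
    (h : AgreeOnSubnets Γ o k F G) (hkm : k ≤ m) (ht : t ∈ Γ)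
    (hcard : (Finset.univ.filter fun i => t i ≠ o i).card ≤ k) : F t = G t := by
  obtain ⟨J, hJ, hJk⟩ := Finset.exists_superset_card_eq hcard (by simpa using hkm)
  refine h J hJk ⟨ht, fun i hi => ?_⟩
  by_contra hne
  exact hi (hJ (by simpa using hne))

/-- The new vertex of `G` lies on circles through six vertices shared with `F`; nondegeneracy of `F`
alone then identifies it. -/
theorem IsCurvatureLineNet.eqOn (hI : ∀ i, (I i).OrdConnected) {o : Fin m → ℤ}
    (ho : o ∈ Set.univ.pi I) {k : ℕ} (hk : 2 ≤ k) (hkm : k ≤ m)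
    (hF : IsCurvatureLineNet (Set.univ.pi I) F) (hF' : IsNondegenerate (Set.univ.pi I) F)
    (hG : IsCurvatureLineNet (Set.univ.pi I) G) (h : AgreeOnSubnets (Set.univ.pi I) o k F G) :
    Set.EqOn F G (Set.univ.pi I) := by
  intro t ht
  refine induction_on_cells (P := fun t => F t = G t) hI ho
    (fun t ht hc => h.eq_of_card_le hkm ht (hc.trans hk)) ?_ ht
  intro t i j l a b c hij hil hjl ht hu h1 h2 h3 h12 h13 h23
  have hbox := box_subset ht hu
  rw [box_three t hij hil hjl] at hbox
  simp only [Set.insert_subset_iff, Set.singleton_subset_iff] at hbox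
  obtain ⟨-, hi, hj, hl, -⟩ := hbox
  have e₂ : step (step (step t j b) i a) l c = step (step (step t i a) j b) l c := by
    rw [step_comm t j i]
  have e₃ : step (step (step t l c) i a) j b = step (step (step t i a) j b) l c := by
    rw [step_comm t l i, step_comm _ l j]
  have f₁ := hG.lieOnSphere_face (a := b) (b := c) hjl hi hu
  have f₂ := hG.lieOnSphere_face (a := a) (b := c) hil hj (e₂ ▸ hu)
  have f₃ := hG.lieOnSphere_face (a := a) (b := b) hij hl (e₃ ▸ hu)
  rw [e₂, step_comm t j i] at f₂
  rw [e₃, step_comm t l i, step_comm t l j] at f₃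
  refine ((eq_opposite_iff hF hF' hij hil hjl ht hu _).2 ?_).symm
  rw [h1, h2, h3, h12, h13, h23]
  exact ⟨f₁, f₂, f₃⟩

/-- On each edge into the new vertex, both values of `F` and the known value of `F'` are distinct,
by `ne` and `hne`, so they fix the edge circle even where `F'` degenerates. -/
theorem IsRibaucourPair.eqOn_right (hI : ∀ i, (I i).OrdConnected) {o : Fin m → ℤ}
    (ho : o ∈ Set.univ.pi I) {k : ℕ} (hk : 2 ≤ k) (hkm : k ≤ m)
    (hF : IsRibaucourPair (Set.univ.pi I) F F') (hn : IsNondegenerate (Set.univ.pi I) F)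
    (hne : ∀ (t : Fin m → ℤ) (i : Fin m) (a : ℤˣ), t ∈ Set.univ.pi I →
      step t i a ∈ Set.univ.pi I → F' t ≠ F (step t i a))
    (hG : IsRibaucourPair (Set.univ.pi I) G G') (hFG : Set.EqOn F G (Set.univ.pi I))
    (h : AgreeOnSubnets (Set.univ.pi I) o k F' G') : Set.EqOn F' G' (Set.univ.pi I) := by
  intro t ht
  refine induction_on_cells (P := fun t => F' t = G' t) hI ho
    (fun t ht hc => h.eq_of_card_le hkm ht (hc.trans hk)) ?_ ht
  intro t i j l a b c hij hil hjl ht hu _ _ _ h12 h13 h23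
  have hbox := box_subset ht hu
  rw [box_three t hij hil hjl] at hbox
  simp only [Set.insert_subset_iff, Set.singleton_subset_iff] at hbox
  obtain ⟨-, -, -, -, hi, hj, hl, -⟩ := hbox
  have hex := hF.left.isCurvatureHexahedron hn hij hil hjl ht hu
  have e₁ : step (step (step t j b) l c) i a = step (step (step t i a) j b) l c := by
    rw [step_comm _ l i, step_comm t j i]
  have e₂ : step (step (step t i a) l c) j b = step (step (step t i a) j b) l c :=
    step_comm _ _ _ _ _
  have x₁ := hF.lieOnSphere_edge (a := a) hl (e₁ ▸ hu)
  have x₂ := hF.lieOnSphere_edge (a := b) hj (e₂ ▸ hu)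
  have x₃ := hF.lieOnSphere_edge hi hu
  have y₁ := hG.lieOnSphere_edge (a := a) hl (e₁ ▸ hu)
  have y₂ := hG.lieOnSphere_edge (a := b) hj (e₂ ▸ hu)
  have y₃ := hG.lieOnSphere_edge hi hu
  have n₁ := hne _ i a hl (e₁ ▸ hu)
  have n₂ := hne _ j b hj (e₂ ▸ hu)
  rw [e₁] at x₁ y₁ n₁
  rw [e₂] at x₂ y₂ n₂
  rw [← hFG hl, ← hFG hu, ← h23] at y₁
  rw [← hFG hj, ← hFG hu, ← h13] at y₂
  rw [← hFG hi, ← hFG hu, ← h12] at y₃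
  -- Here `q` is the new value of `F` and the `rᵢ` are the values of `F'` at its three neighbours;
  -- `x` and `y` are the new values of `F'` and `G'`.
  exact hex.eq_of_edge_circles (hF.ne _ hu).symm (by rw [hFG hu]; exact (hG.ne _ hu).symm)
    (hF.ne _ hl).symm (hF.ne _ hj).symm (hF.ne _ hi).symm n₁ n₂ (hne _ l c hi hu)
    x₁ x₂ x₃ y₁ y₂ y₃

end Lattice

end CurvatureLineNet

theorem mainTheorem1 (n m k : ℕ) (hk : 2 ≤ k) (hkm : k ≤ m)
    (I : Fin m → Set ℤ) (hI : ∀ i, (I i).OrdConnected)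
    (Γ : Set (Fin m → ℤ)) (hΓ : Γ = Set.univ.pi I)
    (o : Fin m → ℤ) (ho : o ∈ Γ) :
    -- a discrete curvature line net is determined by its subnets of dimension `k` through `o`;
    -- in a 3-cell, each vertex is the only common point of the three circles given by the others
    (∀ F : (Fin m → ℤ) → CurvatureLineNet.ConformalSphere n,
      CurvatureLineNet.IsCurvatureLineNet Γ F → CurvatureLineNet.IsNondegenerate Γ F →
      (∀ G : (Fin m → ℤ) → CurvatureLineNet.ConformalSphere n,
        CurvatureLineNet.IsCurvatureLineNet Γ G →
        CurvatureLineNet.AgreeOnSubnets Γ o k F G → Set.EqOn F G Γ) ∧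
      (∀ (t : Fin m → ℤ) (i j l : Fin m) (a b c : ℤˣ), i ≠ j → i ≠ l → j ≠ l → t ∈ Γ →
        CurvatureLineNet.step (CurvatureLineNet.step (CurvatureLineNet.step t i a) j b) l c ∈ Γ →
        ∀ x : CurvatureLineNet.ConformalSphere n,
          x = F (CurvatureLineNet.step
              (CurvatureLineNet.step (CurvatureLineNet.step t i a) j b) l c) ↔
            (CurvatureLineNet.HasRealCrossRatio
              (F (CurvatureLineNet.step t i a))
              (F (CurvatureLineNet.step (CurvatureLineNet.step t i a) j b)) x
              (F (CurvatureLineNet.step (CurvatureLineNet.step t i a) l c)) ∧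
            CurvatureLineNet.HasRealCrossRatio
              (F (CurvatureLineNet.step t j b))
              (F (CurvatureLineNet.step (CurvatureLineNet.step t j b) i a)) x
              (F (CurvatureLineNet.step (CurvatureLineNet.step t j b) l c)) ∧
            CurvatureLineNet.HasRealCrossRatio
              (F (CurvatureLineNet.step t l c))
              (F (CurvatureLineNet.step (CurvatureLineNet.step t l c) i a)) x
              (F (CurvatureLineNet.step (CurvatureLineNet.step t l c) j b))))) ∧
    -- pairs of nets whose given subnets envelope discrete Ribaucour congruences of `k`-spheres
    (∀ F F' : (Fin m → ℤ) → CurvatureLineNet.ConformalSphere n,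
      CurvatureLineNet.IsCurvatureLineNet Γ F → CurvatureLineNet.IsCurvatureLineNet Γ F' →
      CurvatureLineNet.IsNondegenerate Γ F → CurvatureLineNet.IsNondegenerate Γ F' →
      (∀ J : Finset (Fin m), J.card = k →
        CurvatureLineNet.EnvelopeRibaucourCongruence Γ o J F F') →
      ∀ G G' : (Fin m → ℤ) → CurvatureLineNet.ConformalSphere n,
        CurvatureLineNet.IsCurvatureLineNet Γ G → CurvatureLineNet.IsCurvatureLineNet Γ G' →
        CurvatureLineNet.AgreeOnSubnets Γ o k F G → CurvatureLineNet.AgreeOnSubnets Γ o k F' G' →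
        Set.EqOn F G Γ ∧ Set.EqOn F' G' Γ) ∧
    -- Ribaucour pairs of which the second net may degenerate
    (∀ F F' : (Fin m → ℤ) → CurvatureLineNet.ConformalSphere n,
      CurvatureLineNet.IsRibaucourPair Γ F F' → CurvatureLineNet.IsNondegenerate Γ F →
      (∀ (t : Fin m → ℤ) (i : Fin m) (a : ℤˣ), t ∈ Γ → CurvatureLineNet.step t i a ∈ Γ →
        F' t ≠ F (CurvatureLineNet.step t i a)) →
      ∀ G G' : (Fin m → ℤ) → CurvatureLineNet.ConformalSphere n,
        CurvatureLineNet.IsRibaucourPair Γ G G' →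
        CurvatureLineNet.AgreeOnSubnets Γ o k F G → CurvatureLineNet.AgreeOnSubnets Γ o k F' G' →
        Set.EqOn F G Γ ∧ Set.EqOn F' G' Γ) := by
  subst hΓ
  refine ⟨fun F hF hn => ⟨fun G hG h => hF.eqOn hI ho hk hkm hn hG h, ?_⟩,
    fun F F' hF hF' hn hn' _ G G' hG hG' h h' =>
      ⟨hF.eqOn hI ho hk hkm hn hG h, hF'.eqOn hI ho hk hkm hn' hG' h'⟩,
    fun F F' hF hn hne G G' hG h h' => ?_⟩
  · intro t i j l a b c hij hil hjl ht hu x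
    have hperm : ∀ p q r s : CurvatureLineNet.ConformalSphere n,
        CurvatureLineNet.HasRealCrossRatio p q r s ↔
          CurvatureLineNet.LieOnSphere 1 {p, q, s, r} := fun p q r s => by
      rw [CurvatureLineNet.hasRealCrossRatio_iff, Set.pair_comm r s]
    rw [hperm, hperm, hperm, CurvatureLineNet.step_comm t j i, CurvatureLineNet.step_comm t l i,
      CurvatureLineNet.step_comm t l j]
    exact CurvatureLineNet.eq_opposite_iff hF hn hij hil hjl ht hu x
  · have hFG := hF.left.eqOn hI ho hk hkm hn hG.left h
    exact ⟨hFG, hF.eqOn_right hI ho hk hkm hn hne hG hFG h'⟩
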